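/- Let $L^2[0,1]$ be the space of real square integrable functions with its usual inner product $\langle\cdot,\cdot\rangle$ and norm $\|\cdot\|$, and let $\psi_1=1$, $\psi_{2k}(t)=\sqrt2\cos(2\pi kt)$, $\psi_{2k+1}(t)=\sqrt2\sin(2\pi kt)$ ($k\ge1$) be the trigonometric basis. For $p>0$ put $b_1=1$, $b_{2j}=b_{2j+1}=j^{2p}$ ($j\ge1$), and for $\rho>0$ let $$\mathcal W_p^\rho=\Bigl\{f\in L^2[0,1]:\ \sum_{j\ge1}b_j\langle f,\psi_j\rangle^2\le\rho\Bigr\}.$$ For a summable sequence $\upsilon=(\upsilon_j)_{j\ge1}$ of positive weights and $d\ge1$ let $\mathcal N_\upsilon^d$ be the set of self-adjoint nuclear operators $K$ on $L^2[0,1]$ such that $$d^{-2}\sum_{j\ge1}\upsilon_j^2\langle f,\psi_j\rangle^2\ \le\ \|Kf\|^2\ \le\ d^2\sum_{j\ge1}\upsilon_j^2\langle f,\psi_j\rangle^2\qquad\text{for all } f\in L^2[0,1].$$ Consider the functional linear model $Y=\langle\beta,X\rangle+\sigma\epsilon$ with $\sigma>0$, where $X$ is a centered random element of $L^2[0,1]$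 with $\mathbb E\|X\|^2<\infty$ and covariance operator $\Gamma\in\mathcal N_\upsilon^d$, and $\epsilon\sim\mathcal N(0,1)$ is independent of $X$. For $\beta\in L^2[0,1]$ let $\mathbb E_\beta$ denote the expectation under which $(Y_1,X_1),\dots,(Y_n,X_n)$ are i.i.d. copies of $(Y,X)$. Let $s\ge0$ be an integer with $s\le p$, and write $\beta^{(s)}$ for the $s$-th weak derivative of $\beta$ on $(0,1)$. (i) Polynomial case. Let $a>1/2$, $\upsilon_1=1$ and $\upsilon_j=j^{-2a}$ for $j\ge2$. There are $C>0$ and $N\in\mathbb N$, depending only on $p,s,a,\sigma,\rho,d$, such that for every $(X,\epsilon)$ as above, every $n\ge N$ and every estimator $\widetilde\beta^{(s)}$ (a measurable $L^2[0,1]$-valued function of the sample $(Y_i,X_i)_{1\le i\le n}$), $$\sup_{\beta\in\mathcal W_p^\rho}\mathbb E_\beta\bigl\|\widetilde\beta^{(s)}-\beta^{(s)}\bigr\|^2\ \ge\ C\,n^{-(2p-2s)/(2p+2a+1)}.$$ (ii) Exponential case. Let $a>0$, $\upsilon_1=1$ and $\upsilon_j=\exp(-j^{2a})$ for $j\ge2$.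 There are $C>0$ and $N\in\mathbb N$, depending only on $p,s,a,\sigma,\rho,d$, such that for every $(X,\epsilon)$ as above, every $n\ge N$ and every estimator $\widetilde\beta^{(s)}$, $$\sup_{\beta\in\mathcal W_p^\rho}\mathbb E_\beta\bigl\|\widetilde\beta^{(s)}-\beta^{(s)}\bigr\|^2\ \ge\ C\,(\log n)^{-(p-s)/a}.$$ -/

import Mathlib

open MeasureTheory ProbabilityTheory
open scoped ENNReal

noncomputable section

namespace FunctionalRegression

/-- The Hilbert space `L²[0,1]` of real functions. -/
abbrev L2 : Type := Lp ℝ 2 (volume.restrict (Set.Icc (0 : ℝ) 1))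

instance instMeasurableSpaceL2 : MeasurableSpace L2 := borel L2

instance instBorelSpaceL2 : BorelSpace L2 := ⟨rfl⟩

/-- The trigonometric basis `ψ₁ = 1`, `ψ₂ₖ(t) = √2 cos(2πkt)`, `ψ₂ₖ₊₁(t) = √2 sin(2πkt)`, `k ≥ 1`.
Only indices `j ≥ 1` are used. -/
def trigBasis (j : ℕ) (t : ℝ) : ℝ :=
  if j = 1 then 1
  else if Even j then √2 * Real.cos (2 * Real.pi * ((j / 2 : ℕ) : ℝ) * t)
  else √2 * Real.sin (2 * Real.pi * ((j / 2 : ℕ) : ℝ) * t)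

/-- The Fourier coefficient `⟨f, ψⱼ⟩ = ∫₀¹ f(t) ψⱼ(t) dt`. -/
def coef (f : L2) (j : ℕ) : ℝ := ∫ t in Set.Icc (0 : ℝ) 1, f t * trigBasis j t

/-- The weighted squared norm `‖f‖²_w = ∑_{j ≥ 1} wⱼ ⟨f, ψⱼ⟩²`, with values in `[0, ∞]`
(the weights are non-negative). -/
def weightedNormSq (w : ℕ → ℝ) (f : L2) : ℝ≥0∞ :=
  ∑' i : ℕ, ENNReal.ofReal (w (i + 1) * coef f (i + 1) ^ 2)

/-- The weights of the periodic Sobolev space of order `p`: `b₁ = 1`, `b₂ⱼ = b₂ⱼ₊₁ = j^{2p}`,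
`j ≥ 1`. -/
def sobolevWeight (p : ℝ) (j : ℕ) : ℝ :=
  if j = 1 then 1 else ((j / 2 : ℕ) : ℝ) ^ (2 * p)

/-- The Sobolev ellipsoid `W_p^ρ`. -/
def sobolevEllipsoid (p ρ : ℝ) : Set L2 :=
  {f | weightedNormSq (sobolevWeight p) f ≤ ENNReal.ofReal ρ}

/-- `g ∈ L²[0,1]` is the `s`-th weak derivative of `f` on `(0,1)`; it is unique in `L²[0,1]`
when it exists. -/
def HasWeakDeriv (s : ℕ) (f g : L2) : Prop :=
  ∀ φ : ℝ → ℝ, ContDiff ℝ (⊤ : ℕ∞) φ → HasCompactSupport φ → tsupport φ ⊆ Set.Ioo 0 1 →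
    ∫ t in Set.Icc (0 : ℝ) 1, f t * iteratedDeriv s φ t
      = (-1) ^ s * ∫ t in Set.Icc (0 : ℝ) 1, g t * φ t

/-- The polynomially decreasing weights `υ₁ = 1`, `υⱼ = j^{-2a}`, `j ≥ 2`. -/
def polyWeight (a : ℝ) (j : ℕ) : ℝ := if j = 1 then 1 else (j : ℝ) ^ (-(2 * a))

/-- The exponentially decreasing weights `υ₁ = 1`, `υⱼ = exp(-j^{2a})`, `j ≥ 2`. -/
def expWeight (a : ℝ) (j : ℕ) : ℝ := if j = 1 then 1 else Real.exp (-((j : ℝ) ^ (2 * a)))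

/-- Nuclear operators on `L²[0,1]`. -/
def IsNuclear (K : L2 →L[ℝ] L2) : Prop :=
  ∃ x y : ℕ → L2, Summable (fun k => ‖x k‖ * ‖y k‖) ∧
    ∀ f : L2, HasSum (fun k => inner ℝ (x k) f • y k) (K f)

/-- The link condition `K ∈ N_υ^d`: `K` is self-adjoint, nuclear, and
`‖f‖²_{υ²} / d² ≤ ‖K f‖² ≤ d² ‖f‖²_{υ²}` for all `f ∈ L²[0,1]`. -/
structure LinkCondition (υ : ℕ → ℝ) (d : ℝ) (K : L2 →L[ℝ] L2) : Prop where
  selfAdjoint : IsSelfAdjoint K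
  nuclear : IsNuclear K
  lower : ∀ f : L2,
    weightedNormSq (fun j => υ j ^ 2) f / ENNReal.ofReal (d ^ 2) ≤ ENNReal.ofReal (‖K f‖ ^ 2)
  upper : ∀ f : L2,
    ENNReal.ofReal (‖K f‖ ^ 2) ≤ ENNReal.ofReal (d ^ 2) * weightedNormSq (fun j => υ j ^ 2) f

/-- The assumptions on the regressor `X` and the error `ε`: `X` is a centered random element of
`L²[0,1]` with finite second moment whose covariance operator satisfies the link condition, and
`ε` is standard Gaussian and independent of `X`. -/
structure DesignAssumptions {Ω : Type*} [MeasurableSpace Ω] (P : Measure Ω) (υ : ℕ → ℝ) (d : ℝ)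
    (X : Ω → L2) (ε : Ω → ℝ) : Prop where
  measurable_X : Measurable X
  memLp_X : MemLp X 2 P
  centered_X : ∫ x, X x ∂P = 0
  link : LinkCondition υ d (covarianceOperator (P.map X))
  measurable_eps : Measurable ε
  law_eps : P.map ε = gaussianReal 0 1
  indep : IndepFun X ε P

/-- The law of an i.i.d. `n`-sample of `(Y, X)`, where `Y = ⟨β, X⟩ + σ ε`. -/
def sampleLaw {Ω : Type*} [MeasurableSpace Ω] (P : Measure Ω) (X : Ω → L2) (ε : Ω → ℝ) (σ : ℝ)
    (n : ℕ) (β : L2) : Measure (Fin n → ℝ × L2) :=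
  Measure.pi fun _ => P.map fun x => (inner ℝ β (X x) + σ * ε x, X x)

/-- The maximal risk `sup_{β ∈ W_p^ρ} E ‖T - β^{(s)}‖²` of an estimator `T`, a function of the
`n`-sample, of the `s`-th weak derivative `g = β^{(s)}`. -/
def maximalRisk {Ω : Type*} [MeasurableSpace Ω] (P : Measure Ω) (X : Ω → L2) (ε : Ω → ℝ)
    (σ p ρ : ℝ) (s n : ℕ) (T : (Fin n → ℝ × L2) → L2) : ℝ≥0∞ :=
  ⨆ (β : L2) (g : L2) (_ : β ∈ sobolevEllipsoid p ρ) (_ : HasWeakDeriv s β g),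
    ∫⁻ z, ‖T z - g‖ₑ ^ 2 ∂(sampleLaw P X ε σ n β)

end FunctionalRegression

end

open FunctionalRegression

/-! The proof is Assouad's hypercube argument. The candidates are the slopes `∑ ±c ψ` over cosines
`ψ` with frequencies `k + 1`, `k ∈ B`, one independent sign per frequency.

Flipping one sign moves the regression function by `2c⟨ψ, X⟩`. The link condition gives `E⟨ψ, X⟩² ≤
d υ` (`integral_inner_sq_le`), so if `n c² d υ ≤ σ²`, the Hellinger affinity of the two `n`-samples
is at least `1/2` and the sign cannot be recovered (`regression_two_point`). Only the second moment
of `⟨ψ, X⟩` enters, because the noise is Gaussian given `X`.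

The `s`-th derivative multiplies each cosine by `(2π(k + 1))^s` and shifts all phases by the same
angle, so the terms stay orthogonal (`hasWeakDeriv_trigSum`). By Bessel, the squared error dominates
the sum of the coordinate errors. Averaging over all vertices (`sum_le_two_mul_of_hypercube`) adds
up the two-point bounds in `le_maximalRisk`.

It remains to choose `B` and `V = c²`: a block `[m, 2m)` with `m ≍ n^{1/(2p+2a+1)}` in the
polynomial case, and a single frequency of order `(log n)^{1/(2a)}` in the exponential case. -/

namespace FunctionalRegression

/-! ### Product densities and the Hellinger affinity. -/

section Affinity

variable {α : Type*} [MeasurableSpace α]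

lemma lintegral_pi_prod {n : ℕ} (m : Measure α) [SigmaFinite m] (f : Fin n → α → ℝ≥0∞)
    (hf : ∀ i, Measurable (f i)) :
    ∫⁻ z, ∏ i, f i (z i) ∂(Measure.pi fun _ : Fin n => m) = ∏ i, ∫⁻ x, f i x ∂m := by
  induction n with
  | zero => simp
  | succ n ih =>
    have hmp := (measurePreserving_piFinSuccAbove (fun _ : Fin (n + 1) => m) 0).symm
    rw [← hmp.lintegral_comp_emb (MeasurableEquiv.measurableEmbedding _)]
    have h1 : ∀ q : α × (Fin n → α),
        ∏ i, f i ((MeasurableEquiv.piFinSuccAbove (fun _ : Fin (n + 1) => α) 0).symm q i)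
          = f 0 q.1 * ∏ i : Fin n, f i.succ (q.2 i) := by
      intro q
      rw [Fin.prod_univ_succ]
      simp [MeasurableEquiv.piFinSuccAbove]
    simp_rw [h1]
    have h2 : Measurable fun z : Fin n → α => ∏ i : Fin n, f i.succ (z i) :=
      Finset.measurable_prod _ fun i _ => (hf i.succ).comp (measurable_pi_apply i)
    rw [lintegral_prod_mul (hf 0).aemeasurable h2.aemeasurable, Fin.prod_univ_succ]
    congr 1
    exact ih (fun i => f i.succ) fun i => hf _

/-- It suffices to compare on boxes, where the indicator factorizes over the coordinates. All sample
laws thus have product densities against one measure, and their affinities tensorize. -/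
lemma pi_withDensity {n : ℕ} (m : Measure α) [SigmaFinite m] {f : α → ℝ≥0∞} (hf : Measurable f)
    [SigmaFinite (m.withDensity f)] :
    (Measure.pi fun _ : Fin n => m.withDensity f)
      = (Measure.pi fun _ : Fin n => m).withDensity fun z => ∏ i, f (z i) := by
  refine Measure.pi_eq fun s hs => ?_
  have hbox : MeasurableSet (Set.pi Set.univ s) := MeasurableSet.univ_pi hs
  rw [withDensity_apply _ hbox, ← lintegral_indicator hbox]
  have h1 : (Set.pi Set.univ s).indicator (fun z : Fin n → α => ∏ i, f (z i))
      = fun z => ∏ i, (s i).indicator f (z i) := by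
    funext z
    by_cases hz : z ∈ Set.pi Set.univ s
    · rw [Set.indicator_of_mem hz]
      exact Finset.prod_congr rfl fun i _ =>
        (Set.indicator_of_mem (hz i (Set.mem_univ i)) f).symm
    · rw [Set.indicator_of_notMem hz]
      simp only [Set.mem_pi, Set.mem_univ, true_imp_iff, not_forall] at hz
      obtain ⟨i, hi⟩ := hz
      exact (Finset.prod_eq_zero (Finset.mem_univ i) (Set.indicator_of_notMem hi f)).symm
  rw [h1, lintegral_pi_prod m (fun i => (s i).indicator f) fun i => hf.indicator (hs i)]
  refine Finset.prod_congr rfl fun i _ => ?_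
  rw [withDensity_apply _ (hs i), lintegral_indicator (hs i)]

/-- Cauchy–Schwarz for `w √f` and `√g`; the factor from `√g` is at most one. -/
lemma lintegral_mul_affinity_le (M : Measure α) {f g w : α → ℝ≥0∞} (hf : Measurable f)
    (hg : Measurable g) (hw : Measurable w) (hg1 : ∫⁻ x, g x ∂M ≤ 1) :
    (∫⁻ x, w x * (f x * g x) ^ (1 / 2 : ℝ) ∂M) ^ 2 ≤ ∫⁻ x, w x ^ 2 ∂(M.withDensity f) := by
  have hpq : (2 : ℝ).HolderConjugate 2 := Real.HolderConjugate.two_two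
  have h := ENNReal.lintegral_mul_le_Lp_mul_Lq M hpq
    (f := fun x => w x * f x ^ (1 / 2 : ℝ)) (g := fun x => g x ^ (1 / 2 : ℝ))
    (hw.mul (hf.pow_const _)).aemeasurable (hg.pow_const _).aemeasurable
  have e1 : ∀ x, (w x * f x ^ (1 / 2 : ℝ)) ^ (2 : ℝ) = f x * w x ^ 2 := fun x => by
    rw [ENNReal.mul_rpow_of_nonneg _ _ zero_le_two, ← ENNReal.rpow_mul, mul_comm]
    norm_num
  have e2 : ∀ x, (g x ^ (1 / 2 : ℝ)) ^ (2 : ℝ) = g x := fun x => by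
    rw [← ENNReal.rpow_mul]; norm_num
  have e3 : ∀ x, w x * (f x * g x) ^ (1 / 2 : ℝ)
      = ((fun x => w x * f x ^ (1 / 2 : ℝ)) * fun x => g x ^ (1 / 2 : ℝ)) x := fun x => by
    simp only [Pi.mul_apply]
    rw [ENNReal.mul_rpow_of_nonneg _ _ (by norm_num), mul_assoc]
  simp_rw [e1, e2] at h
  simp_rw [e3]
  have h2 : ∫⁻ x, w x ^ 2 ∂(M.withDensity f) = ∫⁻ x, f x * w x ^ 2 ∂M := by
    rw [lintegral_withDensity_eq_lintegral_mul _ hf (hw.pow_const 2)]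
    rfl
  rw [h2]
  calc _ ≤ ((∫⁻ x, f x * w x ^ 2 ∂M) ^ (1 / 2 : ℝ)) ^ 2 := by
        gcongr
        refine h.trans ?_
        calc _ ≤ (∫⁻ x, f x * w x ^ 2 ∂M) ^ (1 / 2 : ℝ) * 1 := by
              gcongr
              exact ENNReal.rpow_le_one hg1 (by norm_num)
          _ = _ := mul_one _
    _ = _ := by
        rw [← ENNReal.rpow_natCast, ← ENNReal.rpow_mul]; norm_num

/-- The two-point bound for estimating a real parameter, in terms of the Hellinger affinity. -/
lemma affinity_sq_mul_le (M : Measure α) {f g : α → ℝ≥0∞} (hf : Measurable f)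
    (hg : Measurable g) (hf1 : ∫⁻ x, f x ∂M ≤ 1) (hg1 : ∫⁻ x, g x ∂M ≤ 1)
    {U : α → ℝ} (hU : Measurable U) (a b : ℝ) :
    (∫⁻ x, (f x * g x) ^ (1 / 2 : ℝ) ∂M) ^ 2 * ‖a - b‖ₑ ^ 2
      ≤ 2 * (∫⁻ x, ‖U x - a‖ₑ ^ 2 ∂(M.withDensity f)
        + ∫⁻ x, ‖U x - b‖ₑ ^ 2 ∂(M.withDensity g)) := by
  have hwa : Measurable fun x => ‖U x - a‖ₑ := (hU.sub_const a).enorm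
  have hwb : Measurable fun x => ‖U x - b‖ₑ := (hU.sub_const b).enorm
  have hh : Measurable fun x => (f x * g x) ^ (1 / 2 : ℝ) := (hf.mul hg).pow_const _
  have ha := lintegral_mul_affinity_le M hf hg hwa hg1
  have hb := lintegral_mul_affinity_le M hg hf hwb hf1
  simp_rw [mul_comm (g _) (f _)] at hb
  set A := ∫⁻ x, ‖U x - a‖ₑ * (f x * g x) ^ (1 / 2 : ℝ) ∂M
  set B := ∫⁻ x, ‖U x - b‖ₑ * (f x * g x) ^ (1 / 2 : ℝ) ∂M
  -- Triangle inequality for `a - b` through `U x`, integrated against `√(f g)`.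
  have h1 : (∫⁻ x, (f x * g x) ^ (1 / 2 : ℝ) ∂M) * ‖a - b‖ₑ ≤ A + B := by
    have h2 : Measurable fun x => ‖U x - a‖ₑ * (f x * g x) ^ (1 / 2 : ℝ) := hwa.mul hh
    rw [← lintegral_mul_const _ hh, ← lintegral_add_left h2]
    refine lintegral_mono fun x => ?_
    rw [mul_comm, ← add_mul]
    gcongr
    have : a - b = -(U x - a) + (U x - b) := by ring
    rw [this]
    refine (enorm_add_le _ _).trans ?_
    rw [enorm_neg]
  rw [← mul_pow]
  calc _ ≤ (A + B) ^ 2 := by gcongr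
    _ ≤ 2 * (A ^ 2 + B ^ 2) := by
        have := ENNReal.rpow_add_le_mul_rpow_add_rpow A B (p := 2) (by norm_num)
        norm_num at this
        exact this
    _ ≤ _ := by gcongr

end Affinity

/-! ### Two-point bound for Gaussian regression with random design. -/

section Regression

variable {E : Type*} [MeasurableSpace E]

/-- The density of `(b x + σ ε, x)` for standard Gaussian noise, with respect to the product of the
Lebesgue measure and the law of the regressor. -/
noncomputable def regressionDensity (σ : ℝ) (b : E → ℝ) (q : ℝ × E) : ℝ≥0∞ :=
  gaussianPDF (b q.2) (Real.toNNReal (σ ^ 2)) q.1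

lemma measurable_regressionDensity (σ : ℝ) {b : E → ℝ} (hb : Measurable b) :
    Measurable (regressionDensity σ b) := by
  have : Measurable fun q : ℝ × E => (b q.2, Real.toNNReal (σ ^ 2), q.1) := by fun_prop
  exact measurable_uncurry_gaussianPDF.comp this

/-- By independence the joint law of `(X, ε)` is a product. On the slice `X = x` the response is
`N(b x, σ²)`, and Fubini reassembles the slices. -/
lemma map_regression {Ω : Type*} [MeasurableSpace Ω] (P : Measure Ω) [IsProbabilityMeasure P]
    {X : Ω → E} {ε : Ω → ℝ} (hX : Measurable X) (hε : Measurable ε)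
    (hlaw : P.map ε = gaussianReal 0 1) (hind : IndepFun X ε P) {σ : ℝ} (hσ : 0 < σ)
    {b : E → ℝ} (hb : Measurable b) :
    P.map (fun ω => (b (X ω) + σ * ε ω, X ω))
      = ((volume : Measure ℝ).prod (P.map X)).withDensity (regressionDensity σ b) := by
  have hprob : IsProbabilityMeasure (P.map X) := Measure.isProbabilityMeasure_map hX.aemeasurable
  have hv : Real.toNNReal (σ ^ 2) ≠ 0 := by
    simpa using hσ.ne'
  have hjoint := (indepFun_iff_map_prod_eq_prod_map_map hX.aemeasurable hε.aemeasurable).1 hind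
  have hG : Measurable fun q : E × ℝ => (b q.1 + σ * q.2, q.1) := by fun_prop
  have hcomp : (fun ω => (b (X ω) + σ * ε ω, X ω))
      = (fun q : E × ℝ => (b q.1 + σ * q.2, q.1)) ∘ fun ω => (X ω, ε ω) := rfl
  ext A hA
  rw [hcomp, ← Measure.map_map hG (hX.prodMk hε), hjoint, hlaw, Measure.map_apply hG hA,
    Measure.prod_apply (hG hA), withDensity_apply _ hA, ← lintegral_indicator hA,
    lintegral_prod_symm' _ ((measurable_regressionDensity σ hb).indicator hA)]
  refine lintegral_congr fun x => ?_
  have hmap : (gaussianReal 0 1).map (fun e => b x + σ * e)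
      = gaussianReal (b x) (Real.toNNReal (σ ^ 2)) := by
    have h1 : (fun e => b x + σ * e) = (fun y => b x + y) ∘ fun e => σ * e := rfl
    rw [h1, ← Measure.map_map (by fun_prop) (by fun_prop), gaussianReal_map_const_mul,
      gaussianReal_map_const_add]
    congr 1
    · simp
    · ext; simp [sq_nonneg]
  have hsec : MeasurableSet ((fun y : ℝ => (y, x)) ⁻¹' A) := (by fun_prop : Measurable fun y : ℝ => (y, x)) hA
  have h2 : Prod.mk x ⁻¹' ((fun q : E × ℝ => (b q.1 + σ * q.2, q.1)) ⁻¹' A)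
      = (fun e => b x + σ * e) ⁻¹' ((fun y : ℝ => (y, x)) ⁻¹' A) := rfl
  rw [h2, ← Measure.map_apply (by fun_prop) hsec, hmap, gaussianReal_apply _ hv,
    ← lintegral_indicator hsec]
  rfl

/-- Completing the square: `(y - a)² + (y - b)² = 2 (y - (a + b)/2)² + (a - b)²/2`. -/
lemma sqrt_gaussianPDF_mul (a b : ℝ) (σ : ℝ) (y : ℝ) (hσ : 0 < σ) :
    (gaussianPDF a (Real.toNNReal (σ ^ 2)) y * gaussianPDF b (Real.toNNReal (σ ^ 2)) y)
        ^ (1 / 2 : ℝ)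
      = ENNReal.ofReal (Real.exp (-((a - b) ^ 2 / (8 * σ ^ 2))))
        * gaussianPDF ((a + b) / 2) (Real.toNNReal (σ ^ 2)) y := by
  simp only [gaussianPDF]
  rw [← ENNReal.ofReal_mul (gaussianPDFReal_nonneg _ _ _),
    ENNReal.ofReal_rpow_of_nonneg (mul_nonneg (gaussianPDFReal_nonneg _ _ _)
      (gaussianPDFReal_nonneg _ _ _)) (by norm_num),
    ← ENNReal.ofReal_mul (Real.exp_pos _).le, ← Real.sqrt_eq_rpow]
  congr 1
  rw [Real.sqrt_eq_iff_mul_self_eq_of_pos]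
  · simp only [gaussianPDFReal, Real.coe_toNNReal _ (sq_nonneg σ)]
    generalize (√(2 * Real.pi * σ ^ 2))⁻¹ = k
    have h : ∀ u v x y : ℝ, u + v + (u + v) = x + y →
        Real.exp u * (k * Real.exp v) * (Real.exp u * (k * Real.exp v))
          = k * Real.exp x * (k * Real.exp y) := by
      intro u v x y h
      calc _ = k * k * Real.exp (u + v + (u + v)) := by simp only [Real.exp_add]; ring
        _ = _ := by rw [h, Real.exp_add]; ring
    refine h _ _ _ _ ?_
    field_simp
    ring
  · exact mul_pos (Real.exp_pos _) (gaussianPDFReal_pos _ _ _ (by simpa using hσ.ne'))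

lemma lintegral_regressionDensity (ν : Measure E) [IsProbabilityMeasure ν] {σ : ℝ} (hσ : 0 < σ)
    {b : E → ℝ} (hb : Measurable b) :
    ∫⁻ q, regressionDensity σ b q ∂((volume : Measure ℝ).prod ν) = 1 := by
  rw [lintegral_prod_symm' _ (measurable_regressionDensity σ hb)]
  have hv : Real.toNNReal (σ ^ 2) ≠ 0 := by simpa using hσ.ne'
  simp only [regressionDensity]
  simp_rw [lintegral_gaussianPDF_eq_one _ hv]
  simp

lemma affinity_regressionDensity (ν : Measure E) [IsProbabilityMeasure ν] {σ : ℝ} (hσ : 0 < σ)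
    {b c : E → ℝ} (hb : Measurable b) (hc : Measurable c) :
    ∫⁻ q, (regressionDensity σ b q * regressionDensity σ c q) ^ (1 / 2 : ℝ)
        ∂((volume : Measure ℝ).prod ν)
      = ∫⁻ x, ENNReal.ofReal (Real.exp (-((b x - c x) ^ 2 / (8 * σ ^ 2)))) ∂ν := by
  have hm : Measurable fun q =>
      (regressionDensity σ b q * regressionDensity σ c q) ^ (1 / 2 : ℝ) :=
    ((measurable_regressionDensity σ hb).mul (measurable_regressionDensity σ hc)).pow_const _
  rw [lintegral_prod_symm' _ hm]
  refine lintegral_congr fun x => ?_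
  simp only [regressionDensity]
  simp_rw [sqrt_gaussianPDF_mul _ _ σ _ hσ]
  rw [lintegral_const_mul _ (measurable_gaussianPDF _ _),
    lintegral_gaussianPDF_eq_one _ (by simpa using hσ.ne'), mul_one]

/-- The inequality `1 - t ≤ exp (-t)` under the integral reduces the affinity to a second moment of
the design. -/
lemma le_affinity_regressionDensity (ν : Measure E) [IsProbabilityMeasure ν] {σ : ℝ} (hσ : 0 < σ)
    {b c : E → ℝ} (hb : Measurable b) (hc : Measurable c)
    (hint : Integrable (fun x => (b x - c x) ^ 2) ν) :
    ENNReal.ofReal (1 - (∫ x, (b x - c x) ^ 2 ∂ν) / (8 * σ ^ 2))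
      ≤ ∫⁻ q, (regressionDensity σ b q * regressionDensity σ c q) ^ (1 / 2 : ℝ)
        ∂((volume : Measure ℝ).prod ν) := by
  rw [affinity_regressionDensity ν hσ hb hc, ← ofReal_integral_eq_lintegral_ofReal]
  · refine ENNReal.ofReal_le_ofReal ?_
    have h1 : 1 - (∫ x, (b x - c x) ^ 2 ∂ν) / (8 * σ ^ 2)
        = ∫ x, (1 - (b x - c x) ^ 2 / (8 * σ ^ 2)) ∂ν := by
      rw [integral_sub (integrable_const _) (hint.div_const _), integral_div]
      simp
    rw [h1]
    refine integral_mono ((integrable_const _).sub (hint.div_const _)) ?_ fun x => ?_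
    · refine Integrable.of_bound (C := 1) (by fun_prop) (ae_of_all _ fun x => ?_)
      rw [Real.norm_eq_abs, Real.abs_exp, Real.exp_le_one_iff]
      have : 0 ≤ (b x - c x) ^ 2 / (8 * σ ^ 2) := by positivity
      linarith
    · have := Real.add_one_le_exp (-((b x - c x) ^ 2 / (8 * σ ^ 2)))
      simp only
      linarith
  · refine Integrable.of_bound (C := 1) (by fun_prop) (ae_of_all _ fun x => ?_)
    rw [Real.norm_eq_abs, Real.abs_exp, Real.exp_le_one_iff]
    have : 0 ≤ (b x - c x) ^ 2 / (8 * σ ^ 2) := by positivity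
    linarith
  · exact ae_of_all _ fun x => (Real.exp_pos _).le

/-- The two-point bound for an `n`-sample of the regression model. -/
lemma regression_two_point (ν : Measure E) [IsProbabilityMeasure ν] {σ : ℝ} (hσ : 0 < σ)
    {b c : E → ℝ} (hb : Measurable b) (hc : Measurable c)
    (hint : Integrable (fun x => (b x - c x) ^ 2) ν) (n : ℕ)
    (hn : n * (∫ x, (b x - c x) ^ 2 ∂ν) ≤ 4 * σ ^ 2)
    {U : (Fin n → ℝ × E) → ℝ} (hU : Measurable U) (u v : ℝ) :
    ENNReal.ofReal ((u - v) ^ 2 / 8) ≤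
      ∫⁻ z, ‖U z - u‖ₑ ^ 2 ∂(Measure.pi fun _ : Fin n =>
          ((volume : Measure ℝ).prod ν).withDensity (regressionDensity σ b))
      + ∫⁻ z, ‖U z - v‖ₑ ^ 2 ∂(Measure.pi fun _ : Fin n =>
          ((volume : Measure ℝ).prod ν).withDensity (regressionDensity σ c)) := by
  have mb := measurable_regressionDensity σ hb
  have mc := measurable_regressionDensity σ hc
  have pb : IsProbabilityMeasure
      (((volume : Measure ℝ).prod ν).withDensity (regressionDensity σ b)) :=
    ⟨by rw [withDensity_apply _ .univ, setLIntegral_univ, lintegral_regressionDensity ν hσ hb]⟩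
  have pc : IsProbabilityMeasure
      (((volume : Measure ℝ).prod ν).withDensity (regressionDensity σ c)) :=
    ⟨by rw [withDensity_apply _ .univ, setLIntegral_univ, lintegral_regressionDensity ν hσ hc]⟩
  rw [pi_withDensity _ mb, pi_withDensity _ mc]
  set m := (volume : Measure ℝ).prod ν
  have hpm : ∀ {f : ℝ × E → ℝ≥0∞}, Measurable f →
      Measurable fun z : Fin n → ℝ × E => ∏ i, f (z i) := fun hf =>
    Finset.measurable_prod _ fun i _ => hf.comp (measurable_pi_apply i)
  have one : ∀ {b : E → ℝ}, Measurable b →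
      ∫⁻ z, ∏ i, regressionDensity σ b (z i) ∂(Measure.pi fun _ : Fin n => m) ≤ 1 := fun hb => by
    rw [lintegral_pi_prod m (fun _ => regressionDensity σ _)
      fun _ => measurable_regressionDensity σ hb, lintegral_regressionDensity ν hσ hb]
    simp
  have key := affinity_sq_mul_le (Measure.pi fun _ : Fin n => m) (hpm mb) (hpm mc)
    (one hb) (one hc) hU u v
  have haff : ENNReal.ofReal (1 / 2)
      ≤ ∫⁻ z, ((∏ i, regressionDensity σ b (z i)) * ∏ i, regressionDensity σ c (z i))
          ^ (1 / 2 : ℝ) ∂(Measure.pi fun _ : Fin n => m) := by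
    simp_rw [← Finset.prod_mul_distrib, ← ENNReal.prod_rpow_of_nonneg (by norm_num : (0:ℝ) ≤ 1 / 2)]
    rw [lintegral_pi_prod m
      (fun _ q => (regressionDensity σ b q * regressionDensity σ c q) ^ (1 / 2 : ℝ))
      fun _ => (mb.mul mc).pow_const _]
    rw [Finset.prod_const, Finset.card_univ, Fintype.card_fin]
    -- For `n = 0` the hypothesis does not bound the integral, but the empty product is `1`.
    rcases Nat.eq_zero_or_pos n with rfl | hpos
    · simp
    have hn1 : (1 : ℝ) ≤ n := by exact_mod_cast hpos
    set I := ∫ x, (b x - c x) ^ 2 ∂ν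
    have hI : 0 ≤ I := integral_nonneg fun x => sq_nonneg _
    have h8 : 0 < 8 * σ ^ 2 := by positivity
    have hsmall : n * (I / (8 * σ ^ 2)) ≤ 1 / 2 := by
      rw [← mul_div_assoc, div_le_iff₀ h8]; linarith
    have hsmall' : I / (8 * σ ^ 2) ≤ 1 / 2 :=
      (le_mul_of_one_le_left (by positivity) hn1).trans hsmall
    -- Bernoulli: the `n`-fold affinity is at least `1 - n I / (8σ²) ≥ 1/2`.
    have hbern := one_add_mul_le_pow (a := -(I / (8 * σ ^ 2))) (by linarith) n
    calc ENNReal.ofReal (1 / 2) ≤ ENNReal.ofReal ((1 - I / (8 * σ ^ 2)) ^ n) := by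
          refine ENNReal.ofReal_le_ofReal ?_
          rw [← sub_eq_add_neg] at hbern
          linarith
      _ = ENNReal.ofReal (1 - I / (8 * σ ^ 2)) ^ n := ENNReal.ofReal_pow (by linarith) n
      _ ≤ _ := by
          gcongr
          exact le_affinity_regressionDensity ν hσ hb hc hint
  have h2 : ENNReal.ofReal (1 / 2) ^ 2 * ‖u - v‖ₑ ^ 2 = 2 * ENNReal.ofReal ((u - v) ^ 2 / 8) := by
    rw [← ofReal_norm, ← ENNReal.ofReal_pow (by norm_num), ← ENNReal.ofReal_pow (norm_nonneg _),
      ← ENNReal.ofReal_mul (by norm_num), show (2 : ℝ≥0∞) = ENNReal.ofReal 2 by simp,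
      ← ENNReal.ofReal_mul (by norm_num), Real.norm_eq_abs, sq_abs]
    congr 1
    ring
  have h3 : 2 * ENNReal.ofReal ((u - v) ^ 2 / 8) ≤ 2 * _ :=
    h2 ▸ (mul_le_mul_left (pow_le_pow_left' haff 2) _).trans key
  exact (ENNReal.mul_le_mul_iff_right (by simp) (by simp)).1 h3

end Regression

end FunctionalRegression

namespace FunctionalRegression

/-! ### Cosine waves, their coefficients and weak derivatives. -/

section Trigonometric

lemma memLp_of_continuous {f : ℝ → ℝ} (hf : Continuous f) :
    MemLp f 2 (volume.restrict (Set.Icc (0 : ℝ) 1)) := by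
  obtain ⟨C, hC⟩ := isCompact_Icc.exists_bound_of_continuousOn (hf.continuousOn (s := Set.Icc 0 1))
  exact MemLp.of_bound hf.aestronglyMeasurable C
    ((ae_restrict_iff' measurableSet_Icc).2 (ae_of_all _ hC))

/-- The class in `L²[0,1]` of a continuous function. -/
noncomputable def ofContinuous (f : ℝ → ℝ) (hf : Continuous f) : L2 := (memLp_of_continuous hf).toLp f

lemma inner_ofContinuous (u : L2) {f : ℝ → ℝ} (hf : Continuous f) :
    inner ℝ u (ofContinuous f hf) = ∫ t in Set.Icc (0 : ℝ) 1, u t * f t := by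
  rw [L2.inner_def]
  refine integral_congr_ae ?_
  filter_upwards [(memLp_of_continuous hf).coeFn_toLp] with t ht
  rw [ofContinuous, ht]
  simp [mul_comm]

lemma inner_ofContinuous_ofContinuous {f g : ℝ → ℝ} (hf : Continuous f) (hg : Continuous g) :
    inner ℝ (ofContinuous f hf) (ofContinuous g hg) = ∫ t in (0 : ℝ)..1, f t * g t := by
  rw [inner_ofContinuous, intervalIntegral.integral_of_le zero_le_one,
    ← integral_Icc_eq_integral_Ioc]
  refine integral_congr_ae ?_
  filter_upwards [(memLp_of_continuous hf).coeFn_toLp] with t ht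
  rw [ofContinuous, ht]

/-- The normalized cosine of frequency `k + 1` and phase `α`. -/
noncomputable def wave (k : ℕ) (α t : ℝ) : ℝ := √2 * Real.cos (2 * Real.pi * ((k + 1 : ℕ) : ℝ) * t + α)

lemma continuous_wave (k : ℕ) (α : ℝ) : Continuous (wave k α) := by
  unfold wave; fun_prop

/-- `wave k α` as an element of `L²[0,1]`. -/
noncomputable def waveL2 (k : ℕ) (α : ℝ) : L2 := ofContinuous (wave k α) (continuous_wave k α)

lemma integral_cos_int_mul (m : ℤ) (α : ℝ) :
    ∫ t in (0 : ℝ)..1, Real.cos (2 * Real.pi * m * t + α) = if m = 0 then Real.cos α else 0 := by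
  split_ifs with h
  · simp [h]
  · have hm : (2 * Real.pi * m : ℝ) ≠ 0 := by
      have : (m : ℝ) ≠ 0 := by exact_mod_cast h
      have := Real.pi_ne_zero
      positivity
    rw [intervalIntegral.integral_comp_mul_add (fun t => Real.cos t) hm, integral_cos]
    have : 2 * Real.pi * m * 1 + α = α + m * (2 * Real.pi) := by ring
    rw [this, Real.sin_add_int_mul_two_pi]
    simp

lemma integral_wave (k : ℕ) (α : ℝ) : ∫ t in (0 : ℝ)..1, wave k α t = 0 := by
  unfold wave
  rw [intervalIntegral.integral_const_mul]
  have := integral_cos_int_mul (k + 1 : ℕ) α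
  rw [if_neg (by omega)] at this
  simp only [Int.cast_natCast] at this
  rw [this, mul_zero]

/-- Product-to-sum gives cosines of frequencies `k - l` and `k + l + 2`. The second is never zero,
so only `k = l` in the first survives integration over the period. -/
lemma inner_waveL2 (k l : ℕ) (α γ : ℝ) :
    inner ℝ (waveL2 k α) (waveL2 l γ) = if k = l then Real.cos (α - γ) else 0 := by
  rw [waveL2, waveL2, inner_ofContinuous_ofContinuous]
  have h : ∀ t, wave k α t * wave l γ t
      = Real.cos (2 * Real.pi * ((k - l : ℤ) : ℝ) * t + (α - γ))
        + Real.cos (2 * Real.pi * ((k + l + 2 : ℤ) : ℝ) * t + (α + γ)) := by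
    intro t
    have h2 : √2 * √2 = (2 : ℝ) := Real.mul_self_sqrt zero_le_two
    set A := 2 * Real.pi * ((k + 1 : ℕ) : ℝ) * t + α with hA
    set B := 2 * Real.pi * ((l + 1 : ℕ) : ℝ) * t + γ with hB
    have e1 : 2 * Real.pi * ((k - l : ℤ) : ℝ) * t + (α - γ) = A - B := by
      rw [hA, hB]; push_cast; ring
    have e2 : 2 * Real.pi * ((k + l + 2 : ℤ) : ℝ) * t + (α + γ) = A + B := by
      rw [hA, hB]; push_cast; ring
    unfold wave
    rw [e1, e2, ← hA, ← hB, Real.cos_sub A B, Real.cos_add A B]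
    clear_value A B
    linear_combination (Real.cos A * Real.cos B) * h2
  simp_rw [h]
  rw [intervalIntegral.integral_add (Continuous.intervalIntegrable (by fun_prop) _ _)
    (Continuous.intervalIntegrable (by fun_prop) _ _), integral_cos_int_mul,
    integral_cos_int_mul, if_neg (by omega : ¬ (k + l + 2 : ℤ) = 0), add_zero]
  congr 1
  simp [sub_eq_zero]

lemma orthonormal_waveL2 (α : ℝ) : Orthonormal ℝ fun k => waveL2 k α := by
  rw [orthonormal_iff_ite]
  intro i j
  rw [inner_waveL2]
  simp

/-- A sine is a cosine of phase `-π/2`, so `inner_waveL2` covers both halves of the basis. In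
particular `wave k 0` is `ψ` of index `2k + 2`. -/
lemma trigBasis_add_two (i : ℕ) :
    trigBasis (i + 2) = wave (i / 2) (if Even i then 0 else -(Real.pi / 2)) := by
  funext t
  have h1 : i + 2 ≠ 1 := by omega
  have h2 : (i + 2) / 2 = i / 2 + 1 := by omega
  have h3 : Even (i + 2) ↔ Even i := by simp [Nat.even_add]
  simp only [trigBasis, wave, h1, if_false, h2, h3]
  split_ifs
  · simp
  · rw [← sub_eq_add_neg, Real.cos_sub_pi_div_two]

lemma coef_waveL2 (k i : ℕ) :
    coef (waveL2 k 0) (i + 1) = if i = 2 * k + 1 then 1 else 0 := by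
  rcases i with _ | i
  · have h1 : trigBasis 1 = fun _ => 1 := by funext t; simp [trigBasis]
    have h2 := inner_ofContinuous (waveL2 k 0) (continuous_const (y := (1 : ℝ)))
    rw [coef, h1, ← h2, waveL2, inner_ofContinuous_ofContinuous]
    simp [integral_wave]
  · have h2 := inner_ofContinuous (waveL2 k 0)
      (continuous_wave (i / 2) (if Even i then 0 else -(Real.pi / 2)))
    rw [coef, trigBasis_add_two, ← h2]
    have h3 := inner_waveL2 k (i / 2) 0 (if Even i then 0 else -(Real.pi / 2))
    rw [waveL2, waveL2] at h3
    rw [waveL2, h3]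
    by_cases he : Even i
    · obtain ⟨r, rfl⟩ := he
      simp only [Even.add_self, if_true, sub_zero, Real.cos_zero]
      exact if_congr (by omega) rfl rfl
    · simp only [he, if_false, zero_sub, neg_neg, Real.cos_pi_div_two, ite_self]
      rw [Nat.not_even_iff_odd] at he
      obtain ⟨r, rfl⟩ := he
      rw [if_neg (by omega)]

lemma continuous_trigBasis (j : ℕ) : Continuous (trigBasis j) := by
  unfold trigBasis
  split_ifs <;> fun_prop

lemma coef_eq_inner (f : L2) (j : ℕ) :
    coef f j = inner ℝ f (ofContinuous (trigBasis j) (continuous_trigBasis j)) :=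
  (inner_ofContinuous f _).symm

/-- The trigonometric sum `∑_{k ∈ B} aₖ wave k α` in `L²[0,1]`. -/
noncomputable def trigSum (B : Finset ℕ) (a : ℕ → ℝ) (α : ℝ) : L2 := ∑ k ∈ B, a k • waveL2 k α

lemma coef_trigSum (B : Finset ℕ) (a : ℕ → ℝ) (i : ℕ) :
    coef (trigSum B a 0) (i + 1) = ∑ k ∈ B, if i = 2 * k + 1 then a k else 0 := by
  rw [coef_eq_inner, trigSum, sum_inner]
  refine Finset.sum_congr rfl fun k _ => ?_
  rw [real_inner_smul_left, ← coef_eq_inner, coef_waveL2]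
  simp

lemma weightedNormSq_trigSum (w : ℕ → ℝ) (B : Finset ℕ) (a : ℕ → ℝ) :
    weightedNormSq w (trigSum B a 0) = ∑ k ∈ B, ENNReal.ofReal (w (2 * k + 2) * a k ^ 2) := by
  have hinj : Set.InjOn (fun k : ℕ => 2 * k + 1) B := fun x _ y _ h => by
    simp only at h; omega
  rw [weightedNormSq, tsum_eq_sum (s := B.image fun k => 2 * k + 1)]
  · rw [Finset.sum_image hinj]
    refine Finset.sum_congr rfl fun k hk => ?_
    rw [coef_trigSum, Finset.sum_eq_single_of_mem k hk, if_pos rfl]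
    intro l _ hl
    rw [if_neg (by omega)]
  · intro i hi
    rw [coef_trigSum, Finset.sum_eq_zero]
    · simp
    · intro k hk
      rw [if_neg]
      rintro rfl
      exact hi (Finset.mem_image_of_mem _ hk)

lemma inner_waveL2_trigSum {B : Finset ℕ} {k : ℕ} (hk : k ∈ B) (a : ℕ → ℝ) (α : ℝ) :
    inner ℝ (waveL2 k α) (trigSum B a α) = a k :=
  (orthonormal_waveL2 α).inner_right_sum a hk

lemma hasDerivAt_wave (k : ℕ) (α t : ℝ) :
    HasDerivAt (wave k α) (2 * Real.pi * ((k + 1 : ℕ) : ℝ) * wave k (α + Real.pi / 2) t) t := by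
  have h1 : HasDerivAt (fun t : ℝ => 2 * Real.pi * ((k + 1 : ℕ) : ℝ) * t + α)
      (2 * Real.pi * ((k + 1 : ℕ) : ℝ)) t := by
    simpa using ((hasDerivAt_id t).const_mul (2 * Real.pi * ((k + 1 : ℕ) : ℝ))).add_const α
  have h2 := h1.cos.const_mul (√2)
  have h3 : 2 * Real.pi * ((k + 1 : ℕ) : ℝ) * wave k (α + Real.pi / 2) t
      = √2 * (-Real.sin (2 * Real.pi * ((k + 1 : ℕ) : ℝ) * t + α)
        * (2 * Real.pi * ((k + 1 : ℕ) : ℝ))) := by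
    rw [wave, ← add_assoc, Real.cos_add_pi_div_two]
    ring
  rw [h3]
  exact h2

/-- Integration by parts `s` times: each one costs a sign and a factor of the angular frequency, and
advances the phase by `π/2`. Boundary terms vanish because `φ` is supported inside `(0, 1)`. -/
lemma inner_waveL2_iteratedDeriv (k s : ℕ) (α : ℝ) (φ : ℝ → ℝ) (hφ : ContDiff ℝ (⊤ : ℕ∞) φ)
    (hsupp : tsupport φ ⊆ Set.Ioo 0 1) (hs : Continuous (iteratedDeriv s φ)) :
    inner ℝ (waveL2 k α) (ofContinuous (iteratedDeriv s φ) hs)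
      = (-1) ^ s * (2 * Real.pi * ((k + 1 : ℕ) : ℝ)) ^ s
        * inner ℝ (waveL2 k (α + s * (Real.pi / 2))) (ofContinuous φ hφ.continuous) := by
  induction s generalizing φ with
  | zero => simp
  | succ s ih =>
    have hd : ContDiff ℝ (⊤ : ℕ∞) (deriv φ) := (contDiff_infty_iff_deriv.1 hφ).2
    have hφd : Differentiable ℝ φ := (contDiff_infty_iff_deriv.1 hφ).1
    have h0 : ∀ x, x ∉ Set.Ioo (0 : ℝ) 1 → φ x = 0 := fun x hx =>
      image_eq_zero_of_notMem_tsupport fun h => hx (hsupp h)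
    have e : iteratedDeriv (s + 1) φ = iteratedDeriv s (deriv φ) := iteratedDeriv_succ'
    simp_rw [e]
    rw [ih (deriv φ) hd (tsupport_deriv_subset.trans hsupp)]
    have hparts : inner ℝ (waveL2 k (α + s * (Real.pi / 2))) (ofContinuous (deriv φ) hd.continuous)
        = -(2 * Real.pi * ((k + 1 : ℕ) : ℝ))
          * inner ℝ (waveL2 k (α + (s + 1 : ℕ) * (Real.pi / 2)))
            (ofContinuous φ hφ.continuous) := by
      rw [waveL2, waveL2, inner_ofContinuous_ofContinuous, inner_ofContinuous_ofContinuous]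
      have hw : Continuous fun t => 2 * Real.pi * ((k + 1 : ℕ) : ℝ)
          * wave k (α + s * (Real.pi / 2) + Real.pi / 2) t :=
        continuous_const.mul (continuous_wave k _)
      rw [intervalIntegral.integral_mul_deriv_eq_deriv_mul
        (fun x _ => hasDerivAt_wave k (α + s * (Real.pi / 2)) x)
        (fun x _ => (hφd x).hasDerivAt) (hw.intervalIntegrable _ _)
        (hd.continuous.intervalIntegrable _ _), h0 0 (by simp), h0 1 (by simp)]
      have e2 : α + s * (Real.pi / 2) + Real.pi / 2 = α + (s + 1 : ℕ) * (Real.pi / 2) := by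
        push_cast; ring
      simp_rw [e2, mul_assoc (2 * Real.pi * ((k + 1 : ℕ) : ℝ))]
      rw [intervalIntegral.integral_const_mul]
      ring
    rw [hparts]
    ring

lemma hasWeakDeriv_trigSum (s : ℕ) (B : Finset ℕ) (a : ℕ → ℝ) :
    HasWeakDeriv s (trigSum B a 0)
      (trigSum B (fun k => a k * (2 * Real.pi * ((k + 1 : ℕ) : ℝ)) ^ s) (s * (Real.pi / 2))) := by
  intro φ hφ _ hsupp
  have hs : Continuous (iteratedDeriv s φ) := hφ.continuous_iteratedDeriv s (by exact_mod_cast le_top)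
  rw [← inner_ofContinuous _ hs, ← inner_ofContinuous _ hφ.continuous, trigSum, trigSum,
    sum_inner, sum_inner, Finset.mul_sum]
  refine Finset.sum_congr rfl fun k _ => ?_
  rw [real_inner_smul_left, real_inner_smul_left, inner_waveL2_iteratedDeriv k s 0 φ hφ hsupp hs,
    zero_add]
  ring

end Trigonometric

/-! ### Second moments of the design under the link condition. -/

section Design

/-- With `Γ` the covariance operator and `ψ` a unit vector, the moment is `⟨Γψ, ψ⟩ ≤ ‖Γψ‖`, and the
upper link bound at `ψ` has a single nonzero term. -/
lemma integral_inner_sq_le {Ω : Type*} [MeasurableSpace Ω] {P : Measure Ω} [IsProbabilityMeasure P]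
    {υ : ℕ → ℝ} {d : ℝ} {X : Ω → L2} {ε : Ω → ℝ} (h : DesignAssumptions P υ d X ε)
    (hd : 0 ≤ d) (hυ : ∀ j, 0 ≤ υ j) (k : ℕ) :
    Integrable (fun x => inner ℝ (waveL2 k 0) x ^ 2) (P.map X) ∧
      ∫ x, inner ℝ (waveL2 k 0) x ^ 2 ∂(P.map X) ≤ d * υ (2 * k + 2) := by
  have hX := h.measurable_X
  have : IsProbabilityMeasure (P.map X) := Measure.isProbabilityMeasure_map hX.aemeasurable
  have : Fact ((2 : ℝ≥0∞) ≠ ⊤) := ⟨by simp⟩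
  have : SecondCountableTopology L2 := Lp.SecondCountableTopology
  have hid : MemLp id 2 (P.map X) :=
    (memLp_map_measure_iff aestronglyMeasurable_id hX.aemeasurable).2 h.memLp_X
  set ψ := waveL2 k 0 with hψ
  have hnorm : ‖ψ‖ = 1 := (orthonormal_waveL2 0).1 k
  refine ⟨?_, ?_⟩
  · exact (((innerSL ℝ ψ).comp_memLp' hid)).integrable_sq
  have hcov : ∫ x, inner ℝ ψ x ^ 2 ∂(P.map X)
      = inner ℝ (covarianceOperator (P.map X) ψ) ψ := by
    rw [covarianceOperator_inner hid]
    simp [sq]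
  rw [hcov]
  calc _ ≤ ‖covarianceOperator (P.map X) ψ‖ * ‖ψ‖ := real_inner_le_norm _ _
    _ = ‖covarianceOperator (P.map X) ψ‖ := by rw [hnorm, mul_one]
    _ ≤ _ := by
      have hu := h.link.upper ψ
      have hsum : trigSum {k} (fun _ => 1) 0 = ψ := by simp [trigSum, hψ]
      rw [← hsum, weightedNormSq_trigSum, hsum, Finset.sum_singleton,
        ← ENNReal.ofReal_mul (by positivity), one_pow, mul_one, ← mul_pow,
        ENNReal.ofReal_le_ofReal_iff (by positivity)] at hu
      exact le_of_sq_le_sq hu (mul_nonneg hd (hυ _))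

end Design

end FunctionalRegression

namespace FunctionalRegression

/-! ### Assouad's hypercube argument. -/

section LowerBound

/-- Averaging over the hypercube of subsets of `B`, where neighbours differ in one element. -/
lemma sum_le_two_mul_of_hypercube {ι : Type*} [DecidableEq ι] (B : Finset ι)
    (R : Finset ι → ι → ℝ≥0∞) (γ : ι → ℝ≥0∞) (M : ℝ≥0∞)
    (hM : ∀ θ ⊆ B, ∑ k ∈ B, R θ k ≤ M)
    (hγ : ∀ θ ⊆ B, ∀ k ∈ B, γ k ≤ R θ k + R (symmDiff θ {k}) k) :
    ∑ k ∈ B, γ k ≤ 2 * M := by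
  -- Flipping coordinate `k` is an involution of the cube, so both halves of the two-point bound
  -- have the same total.
  have hflip : ∀ k ∈ B, ∑ θ ∈ B.powerset, R (symmDiff θ {k}) k = ∑ θ ∈ B.powerset, R θ k := by
    intro k hk
    have hmem : ∀ θ ∈ B.powerset, symmDiff θ {k} ∈ B.powerset := fun θ hθ => by
      rw [Finset.mem_powerset] at hθ ⊢
      exact Finset.symmDiff_subset_union.trans
        (Finset.union_subset hθ (Finset.singleton_subset_iff.2 hk))
    exact Finset.sum_nbij' (fun θ => symmDiff θ {k}) (fun θ => symmDiff θ {k}) hmem hmem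
      (fun θ _ => symmDiff_symmDiff_cancel_right _ _)
      (fun θ _ => symmDiff_symmDiff_cancel_right _ _) fun θ _ => rfl
  have h1 : (B.powerset.card : ℝ≥0∞) * ∑ k ∈ B, γ k ≤ B.powerset.card * (2 * M) := by
    calc (B.powerset.card : ℝ≥0∞) * ∑ k ∈ B, γ k
        = ∑ θ ∈ B.powerset, ∑ k ∈ B, γ k := by rw [Finset.sum_const, nsmul_eq_mul]
      _ ≤ ∑ θ ∈ B.powerset, ∑ k ∈ B, (R θ k + R (symmDiff θ {k}) k) :=
          Finset.sum_le_sum fun θ hθ => Finset.sum_le_sum fun k hk =>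
            hγ θ (Finset.mem_powerset.1 hθ) k hk
      _ = 2 * ∑ θ ∈ B.powerset, ∑ k ∈ B, R θ k := by
          simp_rw [Finset.sum_add_distrib]
          rw [Finset.sum_comm (f := fun θ k => R (symmDiff θ {k}) k),
            Finset.sum_congr rfl hflip, Finset.sum_comm (s := B), two_mul]
      _ ≤ 2 * ∑ θ ∈ B.powerset, M := by
          gcongr with θ hθ
          exact hM θ (Finset.mem_powerset.1 hθ)
      _ = B.powerset.card * (2 * M) := by
          rw [Finset.sum_const, nsmul_eq_mul]; ring
  refine (ENNReal.mul_le_mul_iff_right ?_ (ENNReal.natCast_ne_top _)).1 h1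
  simp

lemma sum_enorm_inner_sq_le (B : Finset ℕ) (α : ℝ) (f : L2) :
    ∑ k ∈ B, ‖inner ℝ (waveL2 k α) f‖ₑ ^ 2 ≤ ‖f‖ₑ ^ 2 := by
  have h := (orthonormal_waveL2 α).sum_inner_products_le (s := B) f
  simp_rw [← ofReal_norm, ← ENNReal.ofReal_pow (norm_nonneg _)]
  rw [← ENNReal.ofReal_sum_of_nonneg fun _ _ => sq_nonneg _]
  exact ENNReal.ofReal_le_ofReal h

lemma sobolevWeight_even (p : ℝ) (k : ℕ) :
    sobolevWeight p (2 * k + 2) = ((k + 1 : ℕ) : ℝ) ^ (2 * p) := by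
  have h1 : 2 * k + 2 ≠ 1 := by omega
  have h2 : (2 * k + 2) / 2 = k + 1 := by omega
  simp only [sobolevWeight, h1, if_false, h2]

/-- The vertex `θ` of the hypercube with sides `[-c, c]`. -/
def vertex (c : ℝ) (θ : Finset ℕ) (k : ℕ) : ℝ := if k ∈ θ then c else -c

lemma vertex_sq (c : ℝ) (θ : Finset ℕ) (k : ℕ) : vertex c θ k ^ 2 = c ^ 2 := by
  unfold vertex; split_ifs <;> ring

lemma vertex_symmDiff_self (c : ℝ) (θ : Finset ℕ) (k : ℕ) :
    vertex c (symmDiff θ {k}) k = -vertex c θ k := by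
  unfold vertex
  by_cases h : k ∈ θ <;> simp [Finset.mem_symmDiff, h]

lemma vertex_symmDiff_of_ne (c : ℝ) (θ : Finset ℕ) {k l : ℕ} (h : l ≠ k) :
    vertex c (symmDiff θ {k}) l = vertex c θ l := by
  unfold vertex
  simp [Finset.mem_symmDiff, h]

/-- The lower bound on the maximal risk given by a hypercube of trigonometric sums with frequencies
`k + 1`, `k ∈ B`, and squared amplitude `V`. -/
theorem le_maximalRisk {Ω : Type*} [MeasurableSpace Ω] {P : Measure Ω} [IsProbabilityMeasure P]
    {υ : ℕ → ℝ} {d : ℝ} {X : Ω → L2} {ε : Ω → ℝ} (h : DesignAssumptions P υ d X ε)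
    (hd : 0 ≤ d) (hυ : ∀ j, 0 ≤ υ j) {σ p ρ : ℝ} (hσ : 0 < σ) (s n : ℕ) (B : Finset ℕ)
    {V : ℝ} (hV : 0 ≤ V) (hell : ∑ k ∈ B, ((k + 1 : ℕ) : ℝ) ^ (2 * p) * V ≤ ρ)
    (hn : ∀ k ∈ B, n * (V * (d * υ (2 * k + 2))) ≤ σ ^ 2)
    {T : (Fin n → ℝ × L2) → L2} (hT : Measurable T) :
    ENNReal.ofReal ((∑ k ∈ B, V * (2 * Real.pi * ((k + 1 : ℕ) : ℝ)) ^ (2 * s)) / 4)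
      ≤ maximalRisk P X ε σ p ρ s n T := by
  obtain ⟨c, rfl⟩ : ∃ c, V = c ^ 2 := ⟨√V, (Real.sq_sqrt hV).symm⟩
  have : IsProbabilityMeasure (P.map X) :=
    Measure.isProbabilityMeasure_map h.measurable_X.aemeasurable
  set α : ℝ := s * (Real.pi / 2)
  set ω : ℕ → ℝ := fun k => 2 * Real.pi * ((k + 1 : ℕ) : ℝ) with hω
  set β : Finset ℕ → L2 := fun θ => trigSum B (vertex c θ) 0 with hβ
  set g : Finset ℕ → L2 := fun θ => trigSum B (fun k => vertex c θ k * ω k ^ s) α with hg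
  have hb : ∀ u : L2, Measurable fun x : L2 => inner ℝ u x := fun u =>
    (continuous_const.inner continuous_id).measurable
  have hlaw : ∀ u : L2, sampleLaw P X ε σ n u = Measure.pi fun _ : Fin n =>
      ((volume : Measure ℝ).prod (P.map X)).withDensity
        (regressionDensity σ fun x => inner ℝ u x) := fun u => by
    rw [sampleLaw, map_regression P h.measurable_X h.measurable_eps h.law_eps h.indep hσ (hb u)]
  have hmem : ∀ θ, β θ ∈ sobolevEllipsoid p ρ := by
    intro θ
    rw [sobolevEllipsoid, Set.mem_ofPred_eq, hβ, weightedNormSq_trigSum]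
    simp_rw [vertex_sq, sobolevWeight_even]
    rw [← ENNReal.ofReal_sum_of_nonneg fun k _ => by positivity]
    exact ENNReal.ofReal_le_ofReal hell
  have hU : ∀ k, Measurable fun z => inner ℝ (waveL2 k α) (T z) := fun k => (hb _).comp hT
  -- The risk at vertex `θ` of estimating the `k`-th coefficient of the derivative, in the basis
  -- with shifted phase `α`.
  set R : Finset ℕ → ℕ → ℝ≥0∞ := fun θ k =>
    ∫⁻ z, ‖inner ℝ (waveL2 k α) (T z) - vertex c θ k * ω k ^ s‖ₑ ^ 2 ∂(sampleLaw P X ε σ n (β θ))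
    with hR
  have hM : ∀ θ ⊆ B, ∑ k ∈ B, R θ k ≤ maximalRisk P X ε σ p ρ s n T := by
    intro θ _
    calc ∑ k ∈ B, R θ k
        = ∫⁻ z, ∑ k ∈ B, ‖inner ℝ (waveL2 k α) (T z) - vertex c θ k * ω k ^ s‖ₑ ^ 2
            ∂(sampleLaw P X ε σ n (β θ)) :=
          (lintegral_finsetSum _ fun k _ => (((hU k).sub_const _).enorm).pow_const 2).symm
      _ ≤ ∫⁻ z, ‖T z - g θ‖ₑ ^ 2 ∂(sampleLaw P X ε σ n (β θ)) := by
          refine lintegral_mono fun z => ?_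
          refine le_trans (le_of_eq ?_) (sum_enorm_inner_sq_le B α (T z - g θ))
          refine Finset.sum_congr rfl fun k hk => ?_
          rw [inner_sub_right, hg, inner_waveL2_trigSum hk]
      _ ≤ _ := by
          rw [maximalRisk]
          exact le_iSup₂_of_le (β θ) (g θ) (le_iSup₂_of_le (hmem θ)
            (hasWeakDeriv_trigSum s B (vertex c θ)) le_rfl)
  -- The two coefficients differ by `2c ω^s` in absolute value, so the two-point constant `1/8`
  -- becomes `1/2`.
  have hγ : ∀ θ ⊆ B, ∀ k ∈ B,
      ENNReal.ofReal (c ^ 2 * ω k ^ (2 * s) / 2) ≤ R θ k + R (symmDiff θ {k}) k := by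
    intro θ _ k hk
    have hdiff : ∀ x : L2, (inner ℝ (β θ) x - inner ℝ (β (symmDiff θ {k})) x) ^ 2
        = 4 * c ^ 2 * inner ℝ (waveL2 k 0) x ^ 2 := by
      intro x
      have e : inner ℝ (β θ) x - inner ℝ (β (symmDiff θ {k})) x
          = 2 * vertex c θ k * inner ℝ (waveL2 k 0) x := by
        simp only [hβ, trigSum, sum_inner, real_inner_smul_left]
        rw [← Finset.sum_sub_distrib, Finset.sum_eq_single_of_mem k hk]
        · rw [vertex_symmDiff_self]; ring
        · intro l _ hl
          rw [vertex_symmDiff_of_ne c θ hl, sub_self]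
      rw [e, mul_pow, mul_pow, vertex_sq]
      norm_num
    obtain ⟨hint, hle⟩ := integral_inner_sq_le h hd hυ k
    have key := regression_two_point (P.map X) hσ (hb (β θ)) (hb (β (symmDiff θ {k})))
      (by simp_rw [hdiff]; exact hint.const_mul _) n
      (by
        simp_rw [hdiff]
        rw [integral_const_mul]
        have h1 := hn k hk
        have h2 : n * (c ^ 2 * ∫ x, inner ℝ (waveL2 k 0) x ^ 2 ∂(P.map X))
            ≤ n * (c ^ 2 * (d * υ (2 * k + 2))) := by gcongr
        linarith)
      (hU k) (vertex c θ k * ω k ^ s) (vertex c (symmDiff θ {k}) k * ω k ^ s)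
    rw [← hlaw, ← hlaw] at key
    refine le_trans (le_of_eq ?_) key
    congr 1
    rw [vertex_symmDiff_self, ← vertex_sq c θ k]
    ring
  have hfin := sum_le_two_mul_of_hypercube B R _ _ hM hγ
  rw [← ENNReal.ofReal_sum_of_nonneg fun k _ => by positivity, ← Finset.sum_div] at hfin
  have h2 : (2 : ℝ≥0∞) = ENNReal.ofReal 2 := by simp
  have h3 : ENNReal.ofReal ((∑ k ∈ B, c ^ 2 * ω k ^ (2 * s)) / 2)
      = 2 * ENNReal.ofReal ((∑ k ∈ B, c ^ 2 * ω k ^ (2 * s)) / 4) := by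
    rw [h2, ← ENNReal.ofReal_mul zero_le_two]
    congr 1
    ring
  rw [h3] at hfin
  exact (ENNReal.mul_le_mul_iff_right (by simp) (by simp)).1 hfin

end LowerBound

/-! ### Choice of frequencies and amplitudes. -/

section Rates

open Real

/-- Take the ceiling of `x^{1/r}`; since this root is at least `1`, rounding up at most doubles it.
-/
lemma exists_nat_between_rpow {x r : ℝ} (hx : 1 ≤ x) (hr : 0 < r) :
    ∃ m : ℕ, 1 ≤ m ∧ x ≤ (m : ℝ) ^ r ∧ (m : ℝ) ≤ 2 * x ^ (1 / r) := by
  have h1 : 1 ≤ x ^ (1 / r) := one_le_rpow hx (by positivity)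
  refine ⟨⌈x ^ (1 / r)⌉₊, Nat.one_le_ceil_iff.2 (by linarith), ?_, ?_⟩
  · calc x = (x ^ (1 / r)) ^ r := by
          rw [← rpow_mul (by linarith), one_div_mul_cancel hr.ne', rpow_one]
      _ ≤ _ := rpow_le_rpow (by positivity) (Nat.le_ceil _) hr.le
  · have := (Nat.ceil_lt_add_one (by linarith : 0 ≤ x ^ (1 / r))).le
    linarith

lemma two_mul_rpow_neg_le {m : ℕ} {x r u : ℝ} (hx : 1 ≤ x) (hu : 0 ≤ u) (hm1 : 1 ≤ m)
    (hm : (m : ℝ) ≤ 2 * x ^ (1 / r)) :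
    2 ^ (-u) * x ^ (-(u / r)) ≤ (m : ℝ) ^ (-u) := by
  have hm0 : (0 : ℝ) < m := by exact_mod_cast hm1
  calc (2 : ℝ) ^ (-u) * x ^ (-(u / r)) = (2 * x ^ (1 / r)) ^ (-u) := by
        rw [mul_rpow zero_le_two (by positivity), ← rpow_mul (by linarith)]
        congr 2
        ring
    _ ≤ _ := rpow_le_rpow_of_nonpos hm0 hm (by linarith)

lemma rpow_le_freq {m k s : ℕ} (hk : m ≤ k) :
    (m : ℝ) ^ (2 * (s : ℝ)) ≤ (2 * Real.pi * ((k + 1 : ℕ) : ℝ)) ^ (2 * s) := by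
  have h : (m : ℝ) ^ (2 * (s : ℝ)) = (m : ℝ) ^ (2 * s) := by
    rw [← rpow_natCast]; push_cast; rfl
  rw [h]
  gcongr
  have h1 : (m : ℝ) ≤ ((k + 1 : ℕ) : ℝ) := by exact_mod_cast hk.trans k.le_succ
  have h2 : (1 : ℝ) ≤ 2 * Real.pi := by linarith [Real.pi_gt_three]
  exact h1.trans (le_mul_of_one_le_left (by positivity) h2)

/-- With `m` frequencies in `(m, 2m]` and `V = κ m^{-2p-1}`, the Sobolev norm is at most `κ 2^{2p}`,
the noise condition reads `n κ d ≤ σ² m^{2p+2a+1}` up to constants that help, and the loss is of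
order `m V m^{2s} = κ m^{-(2p-2s)}`. -/
lemma poly_lower_bound {p σ ρ d : ℝ} {s : ℕ} (hp : 0 < p) (hs : (s : ℝ) ≤ p)
    (hσ : 0 < σ) (hd : 1 ≤ d) {a κ : ℝ} (ha : 0 < a) (hκ : 0 < κ)
    (hκρ : κ * 2 ^ (2 * p) ≤ ρ) (hκσ : κ * d ≤ σ ^ 2)
    {Ω : Type*} [MeasurableSpace Ω] {P : Measure Ω} [IsProbabilityMeasure P]
    {X : Ω → L2} {ε : Ω → ℝ} (h : DesignAssumptions P (polyWeight a) d X ε)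
    {n : ℕ} (hn : 1 ≤ n) {T : (Fin n → ℝ × L2) → L2} (hT : Measurable T) :
    ENNReal.ofReal (κ / 4 * 2 ^ (-(2 * p - 2 * s))
        * (n : ℝ) ^ (-((2 * p - 2 * s) / (2 * p + 2 * a + 1))))
      ≤ maximalRisk P X ε σ p ρ s n T := by
  have hn1 : (1 : ℝ) ≤ n := by exact_mod_cast hn
  obtain ⟨m, hm1, hmn, hm2⟩ := exists_nat_between_rpow hn1 (by linarith : 0 < 2 * p + 2 * a + 1)
  have hm1' : (1 : ℝ) ≤ m := by exact_mod_cast hm1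
  have hm0 : (0 : ℝ) < m := by linarith
  have hυ : ∀ j, 0 ≤ polyWeight a j := fun j => by unfold polyWeight; split_ifs <;> positivity
  have hV : 0 ≤ κ * (m : ℝ) ^ (-(2 * p) - 1) := by positivity
  have hcard : (Finset.Ico m (2 * m)).card = m := by simp; omega
  refine le_trans (ENNReal.ofReal_le_ofReal ?_)
    (le_maximalRisk h (by linarith) hυ hσ s n (Finset.Ico m (2 * m)) hV ?_ ?_ hT)
  · have h1 : (Finset.Ico m (2 * m)).card • (κ * (m : ℝ) ^ (-(2 * p) - 1) * (m : ℝ) ^ (2 * (s : ℝ)))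
        ≤ ∑ k ∈ Finset.Ico m (2 * m), κ * (m : ℝ) ^ (-(2 * p) - 1)
          * (2 * Real.pi * ((k + 1 : ℕ) : ℝ)) ^ (2 * s) := by
      refine Finset.card_nsmul_le_sum _ _ _ fun k hk => ?_
      gcongr
      exact rpow_le_freq (Finset.mem_Ico.1 hk).1
    rw [hcard, nsmul_eq_mul] at h1
    have h2 : (m : ℝ) * (κ * (m : ℝ) ^ (-(2 * p) - 1) * (m : ℝ) ^ (2 * (s : ℝ)))
        = κ * (m : ℝ) ^ (-(2 * p - 2 * s)) := by
      have : (m : ℝ) ^ (-(2 * p - 2 * s)) = (m : ℝ) ^ (1 : ℝ) * (m : ℝ) ^ (-(2 * p) - 1)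
          * (m : ℝ) ^ (2 * (s : ℝ)) := by
        rw [← rpow_add hm0, ← rpow_add hm0]; congr 1; ring
      rw [this, rpow_one]; ring
    rw [h2] at h1
    have h3 := two_mul_rpow_neg_le hn1 (by linarith : 0 ≤ 2 * p - 2 * (s : ℝ)) hm1 hm2
    have h4 := mul_le_mul_of_nonneg_left h3 hκ.le
    linarith
  · have h1 : ∀ k ∈ Finset.Ico m (2 * m),
        ((k + 1 : ℕ) : ℝ) ^ (2 * p) * (κ * (m : ℝ) ^ (-(2 * p) - 1))
          ≤ (2 * m : ℝ) ^ (2 * p) * (κ * (m : ℝ) ^ (-(2 * p) - 1)) := by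
      intro k hk
      have : ((k + 1 : ℕ) : ℝ) ≤ 2 * m := by exact_mod_cast (Finset.mem_Ico.1 hk).2
      gcongr
    refine (Finset.sum_le_card_nsmul _ _ _ h1).trans ?_
    rw [hcard, nsmul_eq_mul, mul_rpow zero_le_two hm0.le]
    have : (1 : ℝ) = (m : ℝ) ^ (1 : ℝ) * (m : ℝ) ^ (2 * p) * (m : ℝ) ^ (-(2 * p) - 1) := by
      rw [← rpow_add hm0, ← rpow_add hm0, ← rpow_zero (m : ℝ)]; congr 1; ring
    rw [rpow_one] at this
    calc _ = κ * 2 ^ (2 * p) * ((m : ℝ) * (m : ℝ) ^ (2 * p) * (m : ℝ) ^ (-(2 * p) - 1)) := by ring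
      _ = κ * 2 ^ (2 * p) := by rw [← this, mul_one]
      _ ≤ ρ := hκρ
  · intro k hk
    have hυk : polyWeight a (2 * k + 2) ≤ (m : ℝ) ^ (-(2 * a)) := by
      rw [polyWeight, if_neg (by omega)]
      refine rpow_le_rpow_of_nonpos hm0 ?_ (by linarith)
      have := (Finset.mem_Ico.1 hk).1
      exact_mod_cast (by omega : m ≤ 2 * k + 2)
    have e : (m : ℝ) ^ (-(2 * p) - 1) * (m : ℝ) ^ (-(2 * a)) = ((m : ℝ) ^ (2 * p + 2 * a + 1))⁻¹ := by
      rw [← rpow_add hm0, ← rpow_neg hm0.le]; congr 1; ring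
    calc (n : ℝ) * (κ * (m : ℝ) ^ (-(2 * p) - 1) * (d * polyWeight a (2 * k + 2)))
        ≤ (n : ℝ) * (κ * (m : ℝ) ^ (-(2 * p) - 1) * (d * (m : ℝ) ^ (-(2 * a)))) := by gcongr
      _ = κ * d * (n * ((m : ℝ) ^ (-(2 * p) - 1) * (m : ℝ) ^ (-(2 * a)))) := by ring
      _ = κ * d * (n * ((m : ℝ) ^ (2 * p + 2 * a + 1))⁻¹) := by rw [e]
      _ ≤ κ * d * 1 := by
          gcongr
          rw [← div_eq_mul_inv]
          exact div_le_one_of_le₀ hmn (by positivity)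
      _ ≤ σ ^ 2 := by linarith

/-- One frequency `m + 1` with `V = κ m^{-2p}` is enough: once `m^{2a} ≥ log n`, the weight is at
most `1/n` and the sign is hidden. -/
lemma exp_lower_bound {p σ ρ d : ℝ} {s : ℕ} (hp : 0 < p) (hs : (s : ℝ) ≤ p)
    (hσ : 0 < σ) (hd : 1 ≤ d) {a κ : ℝ} (ha : 0 < a) (hκ : 0 < κ)
    (hκρ : κ * 2 ^ (2 * p) ≤ ρ) (hκσ : κ * d ≤ σ ^ 2)
    {Ω : Type*} [MeasurableSpace Ω] {P : Measure Ω} [IsProbabilityMeasure P]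
    {X : Ω → L2} {ε : Ω → ℝ} (h : DesignAssumptions P (expWeight a) d X ε)
    {n : ℕ} (hn : 3 ≤ n) {T : (Fin n → ℝ × L2) → L2} (hT : Measurable T) :
    ENNReal.ofReal (κ / 4 * 2 ^ (-(2 * p - 2 * s)) * (Real.log n) ^ (-((p - s) / a)))
      ≤ maximalRisk P X ε σ p ρ s n T := by
  have hn3 : (3 : ℝ) ≤ n := by exact_mod_cast hn
  have hn0 : (0 : ℝ) < n := by linarith
  -- This is where `3 ≤ n` is needed: `e < 3`.
  have hlog : 1 ≤ Real.log n := by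
    rw [Real.le_log_iff_exp_le hn0]
    linarith [Real.exp_one_lt_d9]
  obtain ⟨m, hm1, hmn, hm2⟩ := exists_nat_between_rpow hlog (by linarith : 0 < 2 * a)
  have hm1' : (1 : ℝ) ≤ m := by exact_mod_cast hm1
  have hm0 : (0 : ℝ) < m := by linarith
  have hυ : ∀ j, 0 ≤ expWeight a j := fun j => by unfold expWeight; split_ifs <;> positivity
  have hV : 0 ≤ κ * (m : ℝ) ^ (-(2 * p)) := by positivity
  refine le_trans (ENNReal.ofReal_le_ofReal ?_)
    (le_maximalRisk h (by linarith) hυ hσ s n {m} hV ?_ ?_ hT)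
  · rw [Finset.sum_singleton]
    have h1 : κ * (m : ℝ) ^ (-(2 * p)) * (m : ℝ) ^ (2 * (s : ℝ))
        ≤ κ * (m : ℝ) ^ (-(2 * p)) * (2 * Real.pi * ((m + 1 : ℕ) : ℝ)) ^ (2 * s) := by
      gcongr
      exact rpow_le_freq le_rfl
    have h2 : κ * (m : ℝ) ^ (-(2 * p)) * (m : ℝ) ^ (2 * (s : ℝ))
        = κ * (m : ℝ) ^ (-(2 * p - 2 * s)) := by
      rw [mul_assoc, ← rpow_add hm0]; congr 2; ring
    rw [h2] at h1
    have h3 := two_mul_rpow_neg_le hlog (by linarith : 0 ≤ 2 * p - 2 * (s : ℝ)) hm1 hm2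
    have e : (2 * p - 2 * (s : ℝ)) / (2 * a) = (p - s) / a := by
      rw [← mul_sub, mul_div_mul_left _ _ two_ne_zero]
    rw [e] at h3
    have h4 := mul_le_mul_of_nonneg_left h3 hκ.le
    linarith
  · rw [Finset.sum_singleton]
    have : ((m + 1 : ℕ) : ℝ) ≤ 2 * m := by push_cast; linarith
    calc ((m + 1 : ℕ) : ℝ) ^ (2 * p) * (κ * (m : ℝ) ^ (-(2 * p)))
        ≤ (2 * m : ℝ) ^ (2 * p) * (κ * (m : ℝ) ^ (-(2 * p))) := by gcongr
      _ = κ * 2 ^ (2 * p) * ((m : ℝ) ^ (2 * p) * (m : ℝ) ^ (-(2 * p))) := by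
          rw [mul_rpow zero_le_two hm0.le]; ring
      _ = κ * 2 ^ (2 * p) := by rw [← rpow_add hm0, add_neg_cancel, rpow_zero, mul_one]
      _ ≤ ρ := hκρ
  · intro k hk
    obtain rfl := Finset.mem_singleton.1 hk
    have hυk : expWeight a (2 * k + 2) ≤ (n : ℝ)⁻¹ := by
      rw [expWeight, if_neg (by omega), ← Real.exp_log (inv_pos.2 hn0), Real.log_inv,
        Real.exp_le_exp, neg_le_neg_iff]
      refine hmn.trans (rpow_le_rpow hm0.le ?_ (by linarith))
      exact_mod_cast (by omega : k ≤ 2 * k + 2)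
    have hk1 : (k : ℝ) ^ (-(2 * p)) ≤ 1 := rpow_le_one_of_one_le_of_nonpos hm1' (by linarith)
    calc (n : ℝ) * (κ * (k : ℝ) ^ (-(2 * p)) * (d * expWeight a (2 * k + 2)))
        ≤ (n : ℝ) * (κ * 1 * (d * (n : ℝ)⁻¹)) := by
          gcongr
          exact mul_nonneg (by linarith) (hυ _)
      _ = κ * d := by field_simp
      _ ≤ σ ^ 2 := hκσ

end Rates

end FunctionalRegression

theorem proposition5 (p σ ρ d : ℝ) (s : ℕ) (hp : 0 < p) (hs : (s : ℝ) ≤ p)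
    (hσ : 0 < σ) (hρ : 0 < ρ) (hd : 1 ≤ d) :
    (∀ a : ℝ, 1 / 2 < a → ∃ C : ℝ, 0 < C ∧ ∃ N : ℕ,
      ∀ (Ω : Type*) [MeasurableSpace Ω] (P : Measure Ω) [IsProbabilityMeasure P]
        (X : Ω → L2) (ε : Ω → ℝ), DesignAssumptions P (polyWeight a) d X ε →
      ∀ n : ℕ, N ≤ n → ∀ T : (Fin n → ℝ × L2) → L2, Measurable T →
        ENNReal.ofReal (C * (n : ℝ) ^ (-((2 * p - 2 * s) / (2 * p + 2 * a + 1))))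
          ≤ maximalRisk P X ε σ p ρ s n T) ∧
    (∀ a : ℝ, 0 < a → ∃ C : ℝ, 0 < C ∧ ∃ N : ℕ,
      ∀ (Ω : Type*) [MeasurableSpace Ω] (P : Measure Ω) [IsProbabilityMeasure P]
        (X : Ω → L2) (ε : Ω → ℝ), DesignAssumptions P (expWeight a) d X ε →
      ∀ n : ℕ, N ≤ n → ∀ T : (Fin n → ℝ × L2) → L2, Measurable T →
        ENNReal.ofReal (C * (Real.log n) ^ (-((p - s) / a)))
          ≤ maximalRisk P X ε σ p ρ s n T) := by
  -- The amplitude constant serves both cases: the first bound keeps the cube in the ellipsoid, the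
  -- second keeps neighbours indistinguishable.
  obtain ⟨κ, hκ, hκρ, hκσ⟩ : ∃ κ : ℝ, 0 < κ ∧ κ * 2 ^ (2 * p) ≤ ρ ∧ κ * d ≤ σ ^ 2 := by
    have hd0 : 0 < d := by linarith
    refine ⟨min (ρ / 2 ^ (2 * p)) (σ ^ 2 / d), by positivity, ?_, ?_⟩
    · rw [← le_div_iff₀ (by positivity)]
      exact min_le_left _ _
    · rw [← le_div_iff₀ hd0]
      exact min_le_right _ _
  refine ⟨fun a ha => ⟨κ / 4 * 2 ^ (-(2 * p - 2 * s)), by positivity, 1, ?_⟩,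
    fun a ha => ⟨κ / 4 * 2 ^ (-(2 * p - 2 * s)), by positivity, 3, ?_⟩⟩
  · intro Ω _ P _ X ε h n hn T hT
    exact poly_lower_bound hp hs hσ hd (by linarith) hκ hκρ hκσ h hn hT
  · intro Ω _ P _ X ε h n hn T hT
    exact exp_lower_bound hp hs hσ hd ha hκ hκρ hκσ h hn hT
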